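/- Let $n,p,K\ge 1$ be integers, $\sigma>0$, $t>0$, and let $1=n_1<n_2<\dots<n_K\le n=n_{K+1}-1$. Put $m_k=n_{k+1}-n_k$ for $1\le k\le K$, and let $m_H=K\big/\sum_{k=1}^K\frac1{m_k}$ be the harmonic mean of $m_1,\dots,m_K$. Let $x_1,\dots,x_n\in\mathbb R^p$ be constant on each interval, that is, $x_{n_k}=x_{n_k+1}=\dots=x_{n_{k+1}-1}$ for $1\le k\le K$. Let $y_i=x_i+\epsilon_i$, where $\epsilon_1,\dots,\epsilon_n$ are independent with $\epsilon_i\sim N(0,\sigma^2 I_{p\times p})$, and let $$(\hat x_1,\dots,\hat x_n)=\operatorname*{arg\,min}_{z_1,\dots,z_n\in\mathbb R^p}\ \sum_{i=1}^n\|y_i-z_i\|^2+\lambda\sum_{i=1}^{n-1}\|z_i-z_{i+1}\|$$ be the group fused lasso estimator. Put $M_y=\sigma\max\left(\sqrt{8(\log n+\log t)+p},\,2\sqrt p\right)$ and assume $$25^2M_y\le\lambda<\min_{1\le k\le K}\left(7m_k-\sqrt{m_k}\right)M_y .$$ Then, with probability at least $1-1/t^2$, $$\sum_{i=1}^n\|\hat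 x_i-x_i\|^2\le 6250\,M_y^2\sum_{k=1}^K\log m_k+6000\,K M_y^2+\frac{32\lambda^2K}{m_H}+\frac{125^2M_y^3\,n}{\lambda}.$$ -/

import Mathlib

/-- The group fused lasso objective
`∑ᵢ ‖yᵢ - zᵢ‖² + lam * ∑_{i < n-1} ‖zᵢ - zᵢ₊₁‖` (indices start at `0`). -/
noncomputable def groupFusedLassoObjective {n p : ℕ} (lam : ℝ)
    (y z : Fin n → EuclideanSpace ℝ (Fin p)) : ℝ :=
  ∑ i, ‖y i - z i‖ ^ 2 +
    lam * ∑ i : Fin (n - 1), ‖z ⟨i, by omega⟩ - z ⟨i + 1, by omega⟩‖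

/-- `z` is a solution of the group fused lasso problem with data `y` and parameter `lam`. -/
def IsGroupFusedLassoSolution {n p : ℕ} (lam : ℝ)
    (y z : Fin n → EuclideanSpace ℝ (Fin p)) : Prop :=
  ∀ w : Fin n → EuclideanSpace ℝ (Fin p),
    groupFusedLassoObjective lam y z ≤ groupFusedLassoObjective lam y w

/-- `ν 0 = 0 < ν 1 < ⋯ < ν K = n` cut `{0, …, n-1}` into the `K` consecutive intervals
`[ν k, ν (k+1))`, and the signal `x` is constant on each of them. -/
structure IsPiecewiseConstant {n p K : ℕ} (ν : Fin (K + 1) → ℕ)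
    (x : Fin n → EuclideanSpace ℝ (Fin p)) : Prop where
  strictMono : StrictMono ν
  zero : ν 0 = 0
  last : ν (Fin.last K) = n
  const : ∀ k : Fin K, ∀ i j : Fin n,
    (i : ℕ) ∈ Set.Ico (ν k.castSucc) (ν k.succ) →
    (j : ℕ) ∈ Set.Ico (ν k.castSucc) (ν k.succ) → x i = x j

/-- The length of the `k`-th interval `[ν k, ν (k+1))`. -/
def segmentLength {K : ℕ} (ν : Fin (K + 1) → ℕ) (k : Fin K) : ℕ :=
  ν k.succ - ν k.castSucc

/-- The harmonic mean of the interval lengths. -/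
noncomputable def harmonicMeanLength {K : ℕ} (ν : Fin (K + 1) → ℕ) : ℝ :=
  (K : ℝ) / ∑ k, 1 / (segmentLength ν k : ℝ)

/-- The noise level `M_y = σ max(√(8 (log n + log t) + p), 2 √p)`. -/
noncomputable def noiseLevel (σ : ℝ) (n p : ℕ) (t : ℝ) : ℝ :=
  σ * max (√(8 * (Real.log n + Real.log t) + p)) (2 * √(p : ℝ))

/-! Write `M` for the noise level. A Chernoff bound and a union bound over the `n ^ 2` pairs of
endpoints show that, with the required probability, every sum of noise over an interval of length
`c` has norm at most `M * √c` (`measure_forall_interval_sum_le`). The rest is deterministic.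

Comparing the objective at the minimiser and at `x` bounds `∑ ‖d i‖ ^ 2`, where `d` is the error, by
a noise term and a difference of total variations (`IsGroupFusedLassoSolution.sum_sq_le`). Both
split over the segments: inside a segment the variation of `d` is a gain, and each jump of `x` costs
only the norms of `d` at its two sides.

On one segment, summation by parts runs from each end towards the point where `‖d‖` is least
(`sum_inner_sub_variation_le_segment`). While `M * √i ≤ lam / 2`, the variation pays for both noise
and end terms, up to errors `M * (√(i + 1) - √i) * ‖d i‖`, whose squared weights sum to a logarithm.
Longer stretches restart in blocks of length about `(lam / (2 * M)) ^ 2`, which produces the term `M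
^ 3 * n / lam`. The minimal value of `‖d‖` costs `lam ^ 2 / m`. -/

/-! ### Gaussian tails and the union bound over intervals. -/

open MeasureTheory ProbabilityTheory in
theorem integral_exp_sq_gaussianReal :
    ∫ x, Real.exp (3 / 8 * x ^ 2) ∂(gaussianReal 0 1) = 2 := by
  rw [integral_gaussianReal_eq_integral_smul one_ne_zero]
  -- The exponents combine to `3 / 8 - 1 / 2 = -1 / 8`, so the integral is `√(8π) / √(2π) = 2`.
  have h : ∀ x : ℝ, gaussianPDFReal 0 1 x • Real.exp (3 / 8 * x ^ 2) =
      (√(2 * Real.pi))⁻¹ * Real.exp (-(1 / 8) * x ^ 2) := by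
    intro x
    simp only [gaussianPDFReal, smul_eq_mul, NNReal.coe_one, mul_one, sub_zero]
    rw [mul_assoc, ← Real.exp_add]
    congr 2
    ring
  simp_rw [h]
  rw [integral_const_mul, integral_gaussian, ← Real.sqrt_inv, ← Real.sqrt_mul (by positivity)]
  rw [show (2 * Real.pi)⁻¹ * (Real.pi / (1 / 8)) = 2 ^ 2 by field_simp; norm_num]
  exact Real.sqrt_sq (by norm_num)

open MeasureTheory ProbabilityTheory in
theorem integral_exp_norm_sq_stdGaussian (p : ℕ) :
    ∫ x, Real.exp (3 / 8 * ‖x‖ ^ 2) ∂(stdGaussian (EuclideanSpace ℝ (Fin p))) = 2 ^ p := by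
  rw [← map_pi_eq_stdGaussian, integral_map (by fun_prop)
    (by exact Continuous.aestronglyMeasurable (by fun_prop))]
  simp_rw [EuclideanSpace.real_norm_sq_eq, Finset.mul_sum, Real.exp_sum]
  rw [integral_fintype_prod_eq_pow (fun x : ℝ => Real.exp (3 / 8 * x ^ 2)),
    integral_exp_sq_gaussianReal, Fintype.card_fin]

open MeasureTheory ProbabilityTheory in
/-- A Chernoff bound for the norm of a standard Gaussian vector. -/
theorem stdGaussian_real_norm_ge_le (p : ℕ) {R : ℝ} (hR : 0 ≤ R) :
    (stdGaussian (EuclideanSpace ℝ (Fin p))).real {x | R ≤ ‖x‖} ≤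
      2 ^ p * Real.exp (-(3 / 8 * R ^ 2)) := by
  have hI := integral_exp_norm_sq_stdGaussian p
  have hint : Integrable (fun x => Real.exp (3 / 8 * ‖x‖ ^ 2))
      (stdGaussian (EuclideanSpace ℝ (Fin p))) := by
    -- A non-integrable function has integral `0` by convention, which contradicts the value `2 ^
    -- p`.
    by_contra h
    rw [integral_undef h] at hI
    exact absurd hI.symm (by positivity)
  have h := mul_meas_ge_le_integral_of_nonneg
    (ae_of_all _ fun x => (Real.exp_pos (3 / 8 * ‖x‖ ^ 2)).le) hint (Real.exp (3 / 8 * R ^ 2))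
  rw [hI] at h
  have hsub : (stdGaussian (EuclideanSpace ℝ (Fin p))).real {x | R ≤ ‖x‖} ≤
      (stdGaussian (EuclideanSpace ℝ (Fin p))).real
        {x | Real.exp (3 / 8 * R ^ 2) ≤ Real.exp (3 / 8 * ‖x‖ ^ 2)} := by
    refine measureReal_mono fun x hx => ?_
    have hx' : R ≤ ‖x‖ := hx
    simp only [Set.mem_ofPred_eq, Real.exp_le_exp]
    gcongr
  rw [Real.exp_neg, ← div_eq_mul_inv, le_div_iff₀ (Real.exp_pos _), mul_comm]
  exact (mul_le_mul_of_nonneg_left hsub (Real.exp_pos _).le).trans h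

open MeasureTheory ProbabilityTheory in
/-- A sum of independent isotropic Gaussian vectors is a rescaled standard Gaussian vector. -/
theorem map_sum_isotropic_gaussian {Ω ι : Type*} [MeasurableSpace Ω] {P : Measure Ω}
    [IsProbabilityMeasure P] {p : ℕ} (σ : ℝ) {ε : ι → Ω → EuclideanSpace ℝ (Fin p)}
    (hindep : iIndepFun ε P)
    (hlaw : ∀ i, HasLaw (ε i)
      (multivariateGaussian 0 (σ ^ 2 • (1 : Matrix (Fin p) (Fin p) ℝ))) P) (s : Finset ι) :
    P.map (fun ω => ∑ i ∈ s, ε i ω) =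
      (stdGaussian (EuclideanSpace ℝ (Fin p))).map (fun x => (σ * √(s.card : ℝ)) • x) := by
  have hS : (σ ^ 2 • (1 : Matrix (Fin p) (Fin p) ℝ)).PosSemidef :=
    Matrix.PosSemidef.one.smul (sq_nonneg σ)
  have : IsProbabilityMeasure (P.map (fun ω => ∑ i ∈ s, ε i ω)) :=
    Measure.isProbabilityMeasure_map
      (Finset.aemeasurable_fun_sum _ fun i _ => (hlaw i).aemeasurable)
  have : IsProbabilityMeasure ((stdGaussian (EuclideanSpace ℝ (Fin p))).map
      (fun x => (σ * √(s.card : ℝ)) • x)) :=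
    Measure.isProbabilityMeasure_map (by fun_prop)
  apply Measure.ext_of_charFun
  ext u
  rw [iIndepFun.charFun_map_fun_finsetSum_eq_prod (fun i _ => (hlaw i).aemeasurable)
    (hindep.restrict s), charFun_map_smul, charFun_stdGaussian, Finset.prod_apply]
  simp_rw [(hlaw _).map_eq, charFun_multivariateGaussian hS]
  rw [Finset.prod_const, ← Complex.exp_nat_mul]
  congr 1
  have hu : u.ofLp ⬝ᵥ u.ofLp = ‖u‖ ^ 2 := by
    rw [EuclideanSpace.real_norm_sq_eq]
    simp [dotProduct, sq]
  rw [Matrix.smul_mulVec, Matrix.one_mulVec, dotProduct_smul, hu, norm_smul, ← Complex.ofReal_pow, mul_pow,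
    Real.norm_eq_abs, sq_abs, mul_pow, Real.sq_sqrt (Nat.cast_nonneg _)]
  simp
  ring

/-- Since `log 2 ≤ 3 / 4`, it suffices to add `1 / 4` of `h₁` to `1 / 8` of `h₂`; this is where both
terms of the maximum in `noiseLevel` enter. -/
theorem two_pow_mul_exp_le_of_noiseLevel {p : ℕ} {L R : ℝ} (h₁ : 8 * L + p ≤ R ^ 2)
    (h₂ : 4 * (p : ℝ) ≤ R ^ 2) :
    2 ^ p * Real.exp (-(3 / 8 * R ^ 2)) ≤ Real.exp (-(2 * L)) := by
  have h2 : (2 : ℝ) ^ p ≤ Real.exp (p * (3 / 4)) := by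
    rw [Real.exp_nat_mul]
    gcongr
    rw [← Real.log_le_iff_le_exp (by norm_num)]
    linarith [Real.log_two_lt_d9]
  calc _ ≤ Real.exp (p * (3 / 4)) * Real.exp (-(3 / 8 * R ^ 2)) := by gcongr
    _ = Real.exp (p * (3 / 4) + -(3 / 8 * R ^ 2)) := (Real.exp_add _ _).symm
    _ ≤ _ := Real.exp_le_exp.2 (by linarith)

theorem noiseLevel_nonneg {σ : ℝ} (hσ : 0 ≤ σ) (n p : ℕ) (t : ℝ) : 0 ≤ noiseLevel σ n p t :=
  mul_nonneg hσ (le_max_of_le_left (Real.sqrt_nonneg _))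

open MeasureTheory ProbabilityTheory in
theorem measure_norm_sum_gt_noiseLevel_le {Ω : Type*} [MeasurableSpace Ω] {P : Measure Ω}
    [IsProbabilityMeasure P] {n p : ℕ} {σ t : ℝ} (hσ : 0 < σ) (ht : 0 < t)
    {ε : Fin n → Ω → EuclideanSpace ℝ (Fin p)} (hindep : iIndepFun ε P)
    (hlaw : ∀ i, HasLaw (ε i)
      (multivariateGaussian 0 (σ ^ 2 • (1 : Matrix (Fin p) (Fin p) ℝ))) P) (s : Finset (Fin n)) :
    P {ω | noiseLevel σ n p t * √(s.card : ℝ) < ‖∑ i ∈ s, ε i ω‖} ≤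
      ENNReal.ofReal (1 / (n * t) ^ 2) := by
  rcases s.eq_empty_or_nonempty with rfl | hs
  · simp
  have hn : 0 < n := by
    obtain ⟨i, -⟩ := hs
    exact i.pos
  have hc : 0 < √(s.card : ℝ) := Real.sqrt_pos.2 (by exact_mod_cast hs.card_pos)
  set R := max (√(8 * (Real.log n + Real.log t) + p)) (2 * √(p : ℝ)) with hRdef
  have hR : 0 ≤ R := le_max_of_le_left (Real.sqrt_nonneg _)
  -- This also covers a negative radicand, where `√` is `0`.
  have h₁ : 8 * (Real.log n + Real.log t) + p ≤ R ^ 2 :=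
    Real.sqrt_le_left hR |>.1 (le_max_left _ _)
  have h₂ : 4 * (p : ℝ) ≤ R ^ 2 := by
    have h : 2 * √(p : ℝ) ≤ R := le_max_right _ _
    have := pow_le_pow_left₀ (by positivity) h 2
    rw [mul_pow, Real.sq_sqrt (Nat.cast_nonneg _)] at this
    linarith
  have hm : AEMeasurable (fun ω => ∑ i ∈ s, ε i ω) P :=
    Finset.aemeasurable_fun_sum _ fun i _ => (hlaw i).aemeasurable
  have hms : MeasurableSet {x : EuclideanSpace ℝ (Fin p) |
      noiseLevel σ n p t * √(s.card : ℝ) < ‖x‖} := measurableSet_lt (by fun_prop) (by fun_prop)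
  have hmap := Measure.map_apply_of_aemeasurable hm hms
  rw [map_sum_isotropic_gaussian σ hindep hlaw s, Measure.map_apply (by fun_prop) hms] at hmap
  change P ((fun ω => ∑ i ∈ s, ε i ω) ⁻¹' {x | noiseLevel σ n p t * √(s.card : ℝ) < ‖x‖}) ≤ _
  rw [← hmap]
  calc _ ≤ (stdGaussian (EuclideanSpace ℝ (Fin p))) {x | R ≤ ‖x‖} := by
        refine measure_mono fun x hx => ?_
        have hx' : σ * R * √(s.card : ℝ) < ‖(σ * √(s.card : ℝ)) • x‖ := hx
        rw [norm_smul, Real.norm_eq_abs, abs_of_pos (by positivity), mul_right_comm] at hx'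
        exact (lt_of_mul_lt_mul_left hx' (by positivity)).le
    _ ≤ _ := by
        rw [← ofReal_measureReal]
        refine ENNReal.ofReal_le_ofReal ((stdGaussian_real_norm_ge_le p hR).trans
          ((two_pow_mul_exp_le_of_noiseLevel h₁ h₂).trans_eq ?_))
        rw [← Real.log_mul (by positivity) (by positivity), Real.exp_neg,
          show 2 * Real.log (n * t) = Real.log ((n * t) ^ 2) by rw [Real.log_pow]; norm_num,
          Real.exp_log (by positivity), one_div]

open MeasureTheory ProbabilityTheory in
/-- With high probability all sums of the noise over intervals are small. -/
theorem measure_forall_interval_sum_le {Ω : Type*} [MeasurableSpace Ω] {P : Measure Ω}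
    [IsProbabilityMeasure P] {n p : ℕ} (hn : 0 < n) {σ t : ℝ} (hσ : 0 < σ) (ht : 0 < t)
    {ε : Fin n → Ω → EuclideanSpace ℝ (Fin p)} (hindep : iIndepFun ε P)
    (hlaw : ∀ i, HasLaw (ε i)
      (multivariateGaussian 0 (σ ^ 2 • (1 : Matrix (Fin p) (Fin p) ℝ))) P) :
    ENNReal.ofReal (1 - 1 / t ^ 2) ≤
      P {ω | ∀ i j : Fin n, ‖∑ l ∈ Finset.Icc i j, ε l ω‖ ≤
        noiseLevel σ n p t * √((Finset.Icc i j).card : ℝ)} := by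
  set G := {ω | ∀ i j : Fin n, ‖∑ l ∈ Finset.Icc i j, ε l ω‖ ≤
        noiseLevel σ n p t * √((Finset.Icc i j).card : ℝ)} with hG
  have hbad : P Gᶜ ≤ ENNReal.ofReal (1 / t ^ 2) := by
    have hsub : Gᶜ ⊆ ⋃ q : Fin n × Fin n, {ω | noiseLevel σ n p t *
        √((Finset.Icc q.1 q.2).card : ℝ) < ‖∑ l ∈ Finset.Icc q.1 q.2, ε l ω‖} := by
      intro ω hω
      simp only [hG, Set.mem_compl_iff, Set.mem_ofPred_eq, not_forall, not_le] at hω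
      obtain ⟨i, j, h⟩ := hω
      exact Set.mem_iUnion.2 ⟨(i, j), h⟩
    calc P Gᶜ ≤ _ := measure_mono hsub
      _ ≤ ∑ q : Fin n × Fin n, _ := measure_iUnion_fintype_le _ _
      _ ≤ ∑ q : Fin n × Fin n, ENNReal.ofReal (1 / (n * t) ^ 2) :=
          Finset.sum_le_sum fun q _ => measure_norm_sum_gt_noiseLevel_le hσ ht hindep hlaw _
      _ = ENNReal.ofReal (1 / t ^ 2) := by
          rw [Finset.sum_const, Finset.card_univ, Fintype.card_prod, Fintype.card_fin,
            nsmul_eq_mul, ← ENNReal.ofReal_natCast, ← ENNReal.ofReal_mul (by positivity)]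
          congr 1
          push_cast
          field_simp
  rw [ENNReal.ofReal_sub _ (by positivity), ENNReal.ofReal_one, tsub_le_iff_right]
  calc (1 : ENNReal) = P Set.univ := measure_univ.symm
    _ = P (G ∪ Gᶜ) := by rw [Set.union_compl_self]
    _ ≤ P G + P Gᶜ := measure_union_le _ _
    _ ≤ _ := by gcongr

/-! ### Sums of squared increments of the square root. -/

theorem sq_sqrt_succ_sub_sqrt_le (i : ℕ) :
    (√((i : ℝ) + 1) - √(i : ℝ)) ^ 2 ≤ √((i : ℝ) + 1) - √(i : ℝ) := by
  have h0 : √(i : ℝ) ≤ √((i : ℝ) + 1) := Real.sqrt_le_sqrt (by linarith)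
  have h1 : √((i : ℝ) + 1) ≤ √(i : ℝ) + 1 := by
    rw [Real.sqrt_le_left (by positivity)]
    nlinarith [Real.sq_sqrt (Nat.cast_nonneg (α := ℝ) i), Real.sqrt_nonneg (i : ℝ)]
  nlinarith

theorem sq_sqrt_succ_sub_sqrt_le_inv (i : ℕ) :
    (√((i : ℝ) + 1) - √(i : ℝ)) ^ 2 ≤ ((i : ℝ) + 1)⁻¹ := by
  have h0 : √(i : ℝ) ≤ √((i : ℝ) + 1) := Real.sqrt_le_sqrt (by linarith)
  have ha := Real.sq_sqrt (Nat.cast_nonneg (α := ℝ) i)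
  have hb := Real.sq_sqrt (show (0 : ℝ) ≤ (i : ℝ) + 1 by positivity)
  have ha0 := Real.sqrt_nonneg (i : ℝ)
  rw [← one_div, le_div_iff₀ (by positivity)]
  have h1 : (√((i : ℝ) + 1) - √(i : ℝ)) * √((i : ℝ) + 1) ≤ 1 := by nlinarith
  calc (√((i : ℝ) + 1) - √(i : ℝ)) ^ 2 * ((i : ℝ) + 1)
      = ((√((i : ℝ) + 1) - √(i : ℝ)) * √((i : ℝ) + 1)) ^ 2 := by rw [mul_pow, hb]
    _ ≤ 1 := pow_le_one₀ (mul_nonneg (sub_nonneg.2 h0) (Real.sqrt_nonneg _)) h1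

theorem sum_sq_sqrt_succ_sub_sqrt_le_sqrt (j : ℕ) :
    ∑ i ∈ Finset.range j, (√((i : ℝ) + 1) - √(i : ℝ)) ^ 2 ≤ √(j : ℝ) := by
  refine (Finset.sum_le_sum fun i _ => sq_sqrt_succ_sub_sqrt_le i).trans_eq ?_
  have h := Finset.sum_range_sub (fun i : ℕ => √(i : ℝ)) j
  simpa using h

theorem sum_sq_sqrt_succ_sub_sqrt_le_log (j : ℕ) :
    ∑ i ∈ Finset.range j, (√((i : ℝ) + 1) - √(i : ℝ)) ^ 2 ≤ 1 + Real.log j := by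
  refine (Finset.sum_le_sum fun i _ => sq_sqrt_succ_sub_sqrt_le_inv i).trans ?_
  have h := harmonic_le_one_add_log j
  simpa [harmonic] using h

/-! ### Summation by parts on a single segment. -/

section Segment

variable {E : Type*} [NormedAddCommGroup E] [InnerProductSpace ℝ E]

/-- Summation by parts on a block so short that the total variation penalty dominates the
noise. -/
theorem sum_inner_sub_variation_le {M lam : ℝ} {e f : ℕ → E} {j : ℕ} (hM : 0 ≤ M)
    (he : ∀ i ≤ j, ‖∑ l ∈ Finset.range i, e l‖ ≤ M * √(i : ℝ)) (hj : M * √(j : ℝ) ≤ lam / 2) :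
    ∑ i ∈ Finset.range j, inner ℝ (e i) (f i)
        - lam / 2 * ∑ i ∈ Finset.range j, ‖f i - f (i + 1)‖ + lam / 2 * ‖f 0‖ ≤
      lam / 2 * ‖f j‖ + ∑ i ∈ Finset.range j, M * (√((i : ℝ) + 1) - √(i : ℝ)) * ‖f i‖ := by
  -- The partial noise sum stays paired with the current `f i`. Of each variation term, the share `M
  -- * √(i + 1)` moves this pairing to `f (i + 1)`, and the remainder carries `‖f i‖` to `‖f (i +
  -- 1)‖`.
  have key : ∀ i ≤ j, ∑ l ∈ Finset.range i, inner ℝ (e l) (f l)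
        - inner ℝ (∑ l ∈ Finset.range i, e l) (f i)
        - lam / 2 * ∑ l ∈ Finset.range i, ‖f l - f (l + 1)‖ + lam / 2 * ‖f 0‖ ≤
      (lam / 2 - M * √(i : ℝ)) * ‖f i‖
        + ∑ l ∈ Finset.range i, M * (√((l : ℝ) + 1) - √(l : ℝ)) * ‖f l‖ := by
    intro i
    induction i with
    | zero => simp
    | succ i ih =>
      intro hi
      have ih := ih (by omega)
      simp only [Finset.sum_range_succ]
      set S := ∑ l ∈ Finset.range i, e l
      have hS : ‖S + e i‖ ≤ M * √((i : ℝ) + 1) := by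
        have := he (i + 1) hi
        rw [Finset.sum_range_succ] at this
        exact_mod_cast this
      have hc : M * √((i : ℝ) + 1) ≤ lam / 2 := by
        refine le_trans (mul_le_mul_of_nonneg_left (Real.sqrt_le_sqrt ?_) hM) hj
        exact_mod_cast hi
      have h1 : inner ℝ (S + e i) (f i - f (i + 1)) ≤ M * √((i : ℝ) + 1) * ‖f i - f (i + 1)‖ :=
        (real_inner_le_norm _ _).trans (mul_le_mul_of_nonneg_right hS (norm_nonneg _))
      have h2 : ‖f i‖ - ‖f (i + 1)‖ ≤ ‖f i - f (i + 1)‖ := norm_sub_norm_le _ _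
      have h3 := mul_le_mul_of_nonneg_left h2 (sub_nonneg.2 hc)
      simp only [inner_sub_right, inner_add_left] at h1 ⊢
      push_cast
      linarith
  have h := key j le_rfl
  have h1 : inner ℝ (∑ l ∈ Finset.range j, e l) (f j) ≤ M * √(j : ℝ) * ‖f j‖ :=
    (real_inner_le_norm _ _).trans (mul_le_mul_of_nonneg_right (he j le_rfl) (norm_nonneg _))
  linarith

theorem sum_inner_sub_variation_le_sq {M lam C : ℝ} {e f : ℕ → E} {j : ℕ} (hM : 0 ≤ M)
    (he : ∀ i ≤ j, ‖∑ l ∈ Finset.range i, e l‖ ≤ M * √(i : ℝ)) (hj : M * √(j : ℝ) ≤ lam / 2)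
    (hC : ∑ i ∈ Finset.range j, (√((i : ℝ) + 1) - √(i : ℝ)) ^ 2 ≤ C) :
    ∑ i ∈ Finset.range j, inner ℝ (e i) (f i)
        - lam / 2 * ∑ i ∈ Finset.range j, ‖f i - f (i + 1)‖ + lam / 2 * ‖f 0‖ ≤
      lam / 2 * ‖f j‖ + 1 / 8 * ∑ i ∈ Finset.range j, ‖f i‖ ^ 2 + 2 * M ^ 2 * C := by
  have h := sum_inner_sub_variation_le (f := f) hM he hj
  have h2 : ∑ i ∈ Finset.range j, M * (√((i : ℝ) + 1) - √(i : ℝ)) * ‖f i‖ ≤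
      ∑ i ∈ Finset.range j, (1 / 8 * ‖f i‖ ^ 2
        + 2 * M ^ 2 * (√((i : ℝ) + 1) - √(i : ℝ)) ^ 2) := by
    refine Finset.sum_le_sum fun i _ => ?_
    nlinarith [sq_nonneg (‖f i‖ - 4 * (M * (√((i : ℝ) + 1) - √(i : ℝ))))]
  rw [Finset.sum_add_distrib, ← Finset.mul_sum, ← Finset.mul_sum] at h2
  have h3 := mul_le_mul_of_nonneg_left hC (show 0 ≤ 2 * M ^ 2 by positivity)
  linarith

/-- The estimate for a stretch of arbitrary length, cut into blocks of length `ℓ`. -/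
theorem sum_inner_sub_variation_le_blocks {M lam : ℝ} {ℓ : ℕ} (hM : 0 ≤ M) (hℓ : 0 < ℓ)
    (hℓM : M * √(ℓ : ℝ) ≤ lam / 2) (j : ℕ) {e f : ℕ → E}
    (he : ∀ a c, a + c ≤ j → ‖∑ l ∈ Finset.range c, e (a + l)‖ ≤ M * √(c : ℝ)) :
    ∑ i ∈ Finset.range j, inner ℝ (e i) (f i)
        - lam / 2 * ∑ i ∈ Finset.range j, ‖f i - f (i + 1)‖ + lam / 2 * ‖f 0‖ ≤
      lam / 2 * ‖f j‖ + 1 / 8 * ∑ i ∈ Finset.range j, ‖f i‖ ^ 2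
        + 2 * M ^ 2 * ((j / ℓ + 1) * √(ℓ : ℝ)) := by
  induction j using Nat.strong_induction_on generalizing e f with
  | _ j ih =>
    rcases le_total j ℓ with hj | hj
    · refine sum_inner_sub_variation_le_sq hM (fun i hi => by simpa using he 0 i (by omega))
        ?_ ((sum_sq_sqrt_succ_sub_sqrt_le_sqrt j).trans ?_)
      · refine le_trans ?_ hℓM
        gcongr
      · have h1 : √(j : ℝ) ≤ √(ℓ : ℝ) := by gcongr
        have h2 : 0 ≤ (j : ℝ) / ℓ * √(ℓ : ℝ) := by positivity
        linarith
    -- The term `lam / 2 * ‖f ℓ‖` left by one block is the initial term of the next, so blocks chain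
    -- without loss.
    · obtain ⟨r, rfl⟩ := Nat.exists_eq_add_of_le hj
      have h1 := sum_inner_sub_variation_le_sq (f := f) hM
        (fun i hi => by simpa using he 0 i (by omega)) hℓM (sum_sq_sqrt_succ_sub_sqrt_le_sqrt ℓ)
      have h2 := ih r (by omega) (e := fun i => e (ℓ + i)) (f := fun i => f (ℓ + i))
        (fun a c hac => by simpa only [add_assoc] using he (ℓ + a) c (by omega))
      simp only [Finset.sum_range_add, add_zero, add_assoc] at h2 ⊢
      have h3 : ((ℓ + r : ℕ) : ℝ) / ℓ = r / ℓ + 1 := by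
        push_cast
        field_simp
        ring
      rw [h3]
      linarith

/-- The first block uses the logarithmic bound, the later ones the bound `√ℓ`. The first block's
share of `j / √ℓ` then pays for the last, incomplete block. -/
theorem sum_inner_sub_variation_le_half {M lam : ℝ} {ℓ : ℕ} (hM : 0 ≤ M) (hℓ : 0 < ℓ)
    (hℓM : M * √(ℓ : ℝ) ≤ lam / 2) {j m : ℕ} (hjm : j ≤ m) {e f : ℕ → E}
    (he : ∀ a c, a + c ≤ j → ‖∑ l ∈ Finset.range c, e (a + l)‖ ≤ M * √(c : ℝ)) :
    ∑ i ∈ Finset.range j, inner ℝ (e i) (f i)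
        - lam / 2 * ∑ i ∈ Finset.range j, ‖f i - f (i + 1)‖ + lam / 2 * ‖f 0‖ ≤
      lam / 2 * ‖f j‖ + 1 / 8 * ∑ i ∈ Finset.range j, ‖f i‖ ^ 2
        + 2 * M ^ 2 * (1 + Real.log m + j / √(ℓ : ℝ)) := by
  have hlog : ∀ i ≤ m, Real.log i ≤ Real.log m := by
    intro i hi
    rcases Nat.eq_zero_or_pos i with rfl | h
    · simpa using Real.log_natCast_nonneg m
    · exact Real.log_le_log (by exact_mod_cast h) (by exact_mod_cast hi)
  rcases le_total j ℓ with hj | hj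
  · refine sum_inner_sub_variation_le_sq hM (fun i hi => by simpa using he 0 i (by omega))
      ?_ ((sum_sq_sqrt_succ_sub_sqrt_le_log j).trans ?_)
    · refine le_trans ?_ hℓM
      gcongr
    · have h1 := hlog j hjm
      have h2 : 0 ≤ (j : ℝ) / √(ℓ : ℝ) := by positivity
      linarith
  · obtain ⟨r, rfl⟩ := Nat.exists_eq_add_of_le hj
    have h1 := sum_inner_sub_variation_le_sq (f := f) hM
      (fun i hi => by simpa using he 0 i (by omega)) hℓM (sum_sq_sqrt_succ_sub_sqrt_le_log ℓ)
    have h2 := sum_inner_sub_variation_le_blocks hM hℓ hℓM r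
      (e := fun i => e (ℓ + i)) (f := fun i => f (ℓ + i))
      (fun a c hac => by simpa only [add_assoc] using he (ℓ + a) c (by omega))
    simp only [Finset.sum_range_add, add_zero, add_assoc] at h2 ⊢
    have hs : (0 : ℝ) < √(ℓ : ℝ) := Real.sqrt_pos.2 (by exact_mod_cast hℓ)
    have h3 : ((ℓ + r : ℕ) : ℝ) / √(ℓ : ℝ) = (r / ℓ + 1) * √(ℓ : ℝ) := by
      have hq : √(ℓ : ℝ) * √(ℓ : ℝ) = ℓ := Real.mul_self_sqrt (Nat.cast_nonneg _)
      have hℓ' : (ℓ : ℝ) ≠ 0 := by exact_mod_cast hℓ.ne'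
      rw [div_eq_iff hs.ne', mul_assoc, hq]
      push_cast
      field_simp
      ring
    rw [h3]
    have h4 := mul_le_mul_of_nonneg_left (hlog ℓ (by omega)) (show 0 ≤ 2 * M ^ 2 by positivity)
    linarith

theorem sum_range_reflect_add {A : Type*} [AddCommMonoid A] (g : ℕ → A) (N a c : ℕ)
    (h : a + c ≤ N) :
    ∑ i ∈ Finset.range c, g (N - 1 - (a + i)) = ∑ i ∈ Finset.range c, g (N - a - c + i) := by
  rw [← Finset.sum_range_reflect (fun i => g (N - a - c + i))]
  refine Finset.sum_congr rfl fun i hi => ?_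
  have := Finset.mem_range.1 hi
  congr 1
  omega

/-- The estimate on a whole segment with jumps allowed at both ends. -/
theorem sum_inner_sub_variation_le_segment {M lam : ℝ} {ℓ : ℕ} (hM : 0 ≤ M) (hℓ : 0 < ℓ)
    (hℓM : M * √(ℓ : ℝ) ≤ lam / 2) {m : ℕ} (hm : 0 < m) {e f : ℕ → E}
    (he : ∀ a c, a + c ≤ m → ‖∑ l ∈ Finset.range c, e (a + l)‖ ≤ M * √(c : ℝ)) :
    ∑ i ∈ Finset.range m, inner ℝ (e i) (f i)
        - lam / 2 * ∑ i ∈ Finset.range (m - 1), ‖f i - f (i + 1)‖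
        + lam / 2 * (‖f 0‖ + ‖f (m - 1)‖) ≤
      1 / 4 * ∑ i ∈ Finset.range m, ‖f i‖ ^ 2
        + (M ^ 2 * (6 + 4 * Real.log m + 2 * m / √(ℓ : ℝ)) + 2 * lam ^ 2 / m) := by
  obtain ⟨j, hj, hmin⟩ := Finset.exists_min_image (Finset.range m) (fun i => ‖f i‖)
    ⟨0, Finset.mem_range.2 hm⟩
  obtain ⟨r, rfl⟩ : ∃ r, m = j + 1 + r :=
    Nat.exists_eq_add_of_le (Nat.succ_le_of_lt (Finset.mem_range.1 hj))
  have hL := sum_inner_sub_variation_le_half hM hℓ hℓM (j := j) (m := j + 1 + r) (by omega)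
    (e := e) (f := f) (fun a c h => he a c (by omega))
  -- The right half is read backwards from the end of the segment.
  have hR := sum_inner_sub_variation_le_half hM hℓ hℓM (j := r) (m := j + 1 + r) (by omega)
    (e := fun i => e (j + 1 + r - 1 - i)) (f := fun i => f (j + 1 + r - 1 - i))
    (fun a c h => by
      rw [sum_range_reflect_add e (j + 1 + r) a c (by omega)]
      exact he _ c (by omega))
  have hR1 := sum_range_reflect_add (fun i => inner ℝ (e i) (f i)) (j + 1 + r) 0 r (by omega)
  have hR2 := sum_range_reflect_add (fun i => ‖f i‖ ^ 2) (j + 1 + r) 0 r (by omega)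
  have hR3 : ∑ i ∈ Finset.range r, ‖f (j + 1 + r - 1 - i) - f (j + 1 + r - 1 - (i + 1))‖ =
      ∑ i ∈ Finset.range r, ‖f (j + i) - f (j + i + 1)‖ := by
    rw [← Finset.sum_range_reflect (fun i => ‖f (j + i) - f (j + i + 1)‖)]
    refine Finset.sum_congr rfl fun i hi => ?_
    have := Finset.mem_range.1 hi
    rw [norm_sub_rev]
    congr 3 <;> omega
  simp only [zero_add, Nat.sub_zero, Nat.add_sub_cancel] at hR1 hR2
  simp only [hR1, hR2, hR3] at hR
  rw [show j + 1 + r - 1 - r = j by omega] at hR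
  simp only [Nat.sub_zero] at hR
  rw [show j + 1 + r - 1 = j + r by omega] at hR ⊢
  have hsum : (((j + 1 + r : ℕ) : ℝ)) * ‖f j‖ ^ 2 ≤
      ∑ i ∈ Finset.range (j + 1 + r), ‖f i‖ ^ 2 := by
    have := Finset.card_nsmul_le_sum (Finset.range (j + 1 + r)) (fun i => ‖f i‖ ^ 2) (‖f j‖ ^ 2)
      (fun i hi => pow_le_pow_left₀ (norm_nonneg _) (hmin i hi) 2)
    simpa using this
  have hmid : inner ℝ (e j) (f j) ≤ 1 / 8 * ‖f j‖ ^ 2 + 2 * M ^ 2 := by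
    have h1 : ‖e j‖ ≤ M := by simpa using he j 1 (by omega)
    have h2 := (real_inner_le_norm (e j) (f j)).trans
      (mul_le_mul_of_nonneg_right h1 (norm_nonneg _))
    nlinarith [sq_nonneg (‖f j‖ - 4 * M)]
  have hm' : (0 : ℝ) < ((j + 1 + r : ℕ) : ℝ) := by exact_mod_cast hm
  -- Each half leaves `lam / 2 * ‖f j‖`. By minimality of `‖f j‖`, the quadratic term here is at
  -- most another eighth of `∑ ‖f i‖ ^ 2`.
  have hlam : lam * ‖f j‖ ≤ 1 / 8 * (((j + 1 + r : ℕ) : ℝ) * ‖f j‖ ^ 2)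
      + 2 * lam ^ 2 / ((j + 1 + r : ℕ) : ℝ) := by
    rw [← sub_nonneg]
    have : 1 / 8 * (((j + 1 + r : ℕ) : ℝ) * ‖f j‖ ^ 2)
      + 2 * lam ^ 2 / ((j + 1 + r : ℕ) : ℝ) - lam * ‖f j‖ =
        (((j + 1 + r : ℕ) : ℝ) * ‖f j‖ - 4 * lam) ^ 2 / (8 * ((j + 1 + r : ℕ) : ℝ)) := by
      field_simp
      ring
    rw [this]
    positivity
  have hlen : (j : ℝ) / √(ℓ : ℝ) + r / √(ℓ : ℝ) ≤ ((j + 1 + r : ℕ) : ℝ) / √(ℓ : ℝ) := by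
    rw [← add_div]
    gcongr
    push_cast
    linarith
  have hlen' := mul_le_mul_of_nonneg_left hlen (show 0 ≤ 2 * M ^ 2 by positivity)
  rw [mul_div_assoc 2 ((j + 1 + r : ℕ) : ℝ)]
  simp only [Finset.sum_range_add, Finset.sum_range_succ] at hsum ⊢
  linarith

end Segment

/-! ### Splitting sums and total variation over the segments. -/

theorem Fin.sum_sub_castSucc_succ {K : ℕ} (h : Fin (K + 1) → ℝ) :
    ∑ k : Fin K, (h k.succ - h k.castSucc) = h (Fin.last K) - h 0 := by
  have h1 := Fin.sum_univ_succ h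
  have h2 := Fin.sum_univ_castSucc h
  rw [Finset.sum_sub_distrib]
  linarith

theorem sum_range_eq_sum_segments {K n : ℕ} {ν : Fin (K + 1) → ℕ} (hν : StrictMono ν)
    (h0 : ν 0 = 0) (hlast : ν (Fin.last K) = n) (h : ℕ → ℝ) :
    ∑ i ∈ Finset.range n, h i =
      ∑ k : Fin K, ∑ i ∈ Finset.range (segmentLength ν k), h (ν k.castSucc + i) := by
  have h1 := Fin.sum_sub_castSucc_succ (fun k => ∑ i ∈ Finset.range (ν k), h i)
  rw [h0, hlast, Finset.sum_range_zero, sub_zero] at h1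
  rw [← h1]
  refine Finset.sum_congr rfl fun k _ => ?_
  rw [segmentLength, ← Finset.sum_Ico_eq_sum_range,
    Finset.sum_Ico_eq_sub _ (hν (Fin.castSucc_lt_succ (i := k))).le]

theorem segmentLength_pos {K : ℕ} {ν : Fin (K + 1) → ℕ} (hν : StrictMono ν) (k : Fin K) :
    0 < segmentLength ν k :=
  Nat.sub_pos_of_lt (hν (Fin.castSucc_lt_succ (i := k)))

/-- The difference of the total variations of `x` and `z` splits over the segments on which
`x` is constant. -/
theorem variation_sub_le_sum_segments {E : Type*} [NormedAddCommGroup E] {K n : ℕ}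
    {ν : Fin (K + 1) → ℕ} (hν : StrictMono ν) (h0 : ν 0 = 0) (hlast : ν (Fin.last K) = n)
    {x z d : ℕ → E} (hd : ∀ i, d i = z i - x i) (hdn : d n = 0)
    (hx : ∀ k : Fin K, ∀ i, i < segmentLength ν k → x (ν k.castSucc + i) = x (ν k.castSucc)) :
    ∑ i ∈ Finset.range (n - 1), ‖x i - x (i + 1)‖ - ∑ i ∈ Finset.range (n - 1), ‖z i - z (i + 1)‖ ≤
      ∑ k : Fin K, (‖d (ν k.castSucc)‖ + ‖d (ν k.castSucc + (segmentLength ν k - 1))‖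
        - ∑ i ∈ Finset.range (segmentLength ν k - 1),
            ‖d (ν k.castSucc + i) - d (ν k.castSucc + (i + 1))‖) := by
  -- The value `0` at `i = n - 1` lets the sum run over all of `range n`, which splits exactly into
  -- segments.
  set T : ℕ → ℝ := fun i =>
    if i + 1 < n then ‖x i - x (i + 1)‖ - ‖z i - z (i + 1)‖ else 0 with hT
  have hLHS : ∑ i ∈ Finset.range (n - 1), ‖x i - x (i + 1)‖
      - ∑ i ∈ Finset.range (n - 1), ‖z i - z (i + 1)‖ = ∑ i ∈ Finset.range n, T i := by
    rw [← Finset.sum_sub_distrib]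
    have h1 : ∑ i ∈ Finset.range (n - 1), (‖x i - x (i + 1)‖ - ‖z i - z (i + 1)‖) =
        ∑ i ∈ Finset.range (n - 1), T i := by
      refine Finset.sum_congr rfl fun i hi => ?_
      have := Finset.mem_range.1 hi
      rw [hT]
      simp only
      rw [if_pos (by omega)]
    rw [h1]
    refine Finset.sum_subset (Finset.range_mono (by omega)) fun i _ hi => ?_
    have : ¬ i < n - 1 := fun h => hi (Finset.mem_range.2 h)
    rw [hT]
    simp only
    rw [if_neg (by omega)]
  have hseg : ∀ k : Fin K, ∑ i ∈ Finset.range (segmentLength ν k), T (ν k.castSucc + i) ≤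
      ‖d (ν k.castSucc + (segmentLength ν k - 1))‖ + ‖d (ν k.succ)‖
        - ∑ i ∈ Finset.range (segmentLength ν k - 1),
            ‖d (ν k.castSucc + i) - d (ν k.castSucc + (i + 1))‖ := by
    intro k
    have hm := segmentLength_pos hν k
    have hsucc : ν k.succ = ν k.castSucc + segmentLength ν k := by
      unfold segmentLength at hm ⊢
      omega
    have hle : ν k.succ ≤ n := hlast ▸ hν.monotone (Fin.le_last _)
    have hx := hx k
    rw [hsucc] at hle ⊢
    obtain ⟨r, hr⟩ : ∃ r, segmentLength ν k = r + 1 := ⟨_, (Nat.sub_add_cancel hm).symm⟩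
    rw [hr] at hx hle ⊢
    generalize ν k.castSucc = a at hx hle ⊢
    rw [Finset.sum_range_succ, Nat.add_sub_cancel]
    have h1 : ∑ i ∈ Finset.range r, T (a + i) =
        -∑ i ∈ Finset.range r, ‖d (a + i) - d (a + (i + 1))‖ := by
      rw [← Finset.sum_neg_distrib]
      refine Finset.sum_congr rfl fun i hi => ?_
      have hi := Finset.mem_range.1 hi
      rw [hT]
      simp only
      rw [if_pos (by omega), hd, hd, add_assoc, hx i (by omega), hx (i + 1) (by omega)]
      simp
    have h2 : T (a + r) ≤ ‖d (a + r)‖ + ‖d (a + (r + 1))‖ := by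
      rw [hT]
      simp only
      split_ifs
      · refine (norm_sub_norm_le _ _).trans ?_
        refine le_trans (le_of_eq ?_) (norm_sub_le (d (a + (r + 1))) (d (a + r)) |>.trans_eq
          (add_comm _ _))
        rw [hd, hd, ← add_assoc]
        congr 1
        abel
      · positivity
    linarith
  rw [hLHS, sum_range_eq_sum_segments hν h0 hlast]
  refine (Finset.sum_le_sum fun k _ => hseg k).trans ?_
  -- Telescoping reassigns the right side of each jump to the segment starting there.
  have htel := Fin.sum_sub_castSucc_succ (fun k => ‖d (ν k)‖)
  simp only [hlast, hdn, norm_zero] at htel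
  simp only [Finset.sum_sub_distrib, Finset.sum_add_distrib] at htel ⊢
  linarith [norm_nonneg (d (ν 0))]

/-! ### The basic inequality and the deterministic error bound. -/

/-- Extension of a finite sequence by zero. -/
def zeroExtend {E : Type*} [Zero E] {n : ℕ} (v : Fin n → E) (i : ℕ) : E :=
  if h : i < n then v ⟨i, h⟩ else 0

theorem zeroExtend_of_lt {E : Type*} [Zero E] {n : ℕ} (v : Fin n → E) {i : ℕ} (h : i < n) :
    zeroExtend v i = v ⟨i, h⟩ :=
  dif_pos h

theorem zeroExtend_val {E : Type*} [Zero E] {n : ℕ} (v : Fin n → E) (i : Fin n) :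
    zeroExtend v i = v i :=
  zeroExtend_of_lt v i.isLt

theorem zeroExtend_self {E : Type*} [Zero E] {n : ℕ} (v : Fin n → E) :
    zeroExtend v n = 0 :=
  dif_neg (lt_irrefl n)

theorem zeroExtend_sub {E : Type*} [AddGroup E] {n : ℕ} (v w : Fin n → E) (i : ℕ) :
    zeroExtend (fun i => v i - w i) i = zeroExtend v i - zeroExtend w i := by
  unfold zeroExtend
  split_ifs <;> simp

theorem groupFusedLassoObjective_eq {n p : ℕ} (lam : ℝ)
    (y z : Fin n → EuclideanSpace ℝ (Fin p)) :
    groupFusedLassoObjective lam y z = ∑ i, ‖y i - z i‖ ^ 2 +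
      lam * ∑ i ∈ Finset.range (n - 1), ‖zeroExtend z i - zeroExtend z (i + 1)‖ := by
  rw [groupFusedLassoObjective, Finset.sum_range]
  congr 2
  refine Finset.sum_congr rfl fun i _ => ?_
  rw [zeroExtend_of_lt z (by omega : (i : ℕ) < n), zeroExtend_of_lt z (by omega : (i : ℕ) + 1 < n)]

/-- The basic inequality for the group fused lasso. -/
theorem IsGroupFusedLassoSolution.sum_sq_le {n p : ℕ} {lam : ℝ}
    {x ε z : Fin n → EuclideanSpace ℝ (Fin p)}
    (hz : IsGroupFusedLassoSolution lam (fun i => x i + ε i) z) :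
    ∑ i, ‖z i - x i‖ ^ 2 ≤ 2 * ∑ i, inner ℝ (ε i) (z i - x i) +
      lam * (∑ i ∈ Finset.range (n - 1), ‖zeroExtend x i - zeroExtend x (i + 1)‖ -
        ∑ i ∈ Finset.range (n - 1), ‖zeroExtend z i - zeroExtend z (i + 1)‖) := by
  have h := hz x
  rw [groupFusedLassoObjective_eq, groupFusedLassoObjective_eq] at h
  have h1 : ∑ i, ‖x i + ε i - z i‖ ^ 2 = ∑ i, ‖x i + ε i - x i‖ ^ 2
      - 2 * ∑ i, inner ℝ (ε i) (z i - x i) + ∑ i, ‖z i - x i‖ ^ 2 := by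
    rw [Finset.mul_sum, ← Finset.sum_sub_distrib, ← Finset.sum_add_distrib]
    refine Finset.sum_congr rfl fun i _ => ?_
    rw [add_sub_cancel_left, ← norm_sub_sq_real]
    congr 2
    abel
  linarith

theorem norm_sum_zeroExtend_le {E : Type*} [NormedAddCommGroup E] {n : ℕ} {ε : Fin n → E} {M : ℝ}
    (hε : ∀ i j : Fin n, ‖∑ l ∈ Finset.Icc i j, ε l‖ ≤ M * √((Finset.Icc i j).card : ℝ))
    (a c : ℕ) (hac : a + c ≤ n) :
    ‖∑ l ∈ Finset.range c, zeroExtend ε (a + l)‖ ≤ M * √(c : ℝ) := by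
  rcases Nat.eq_zero_or_pos c with rfl | hc
  · simp
  have h := hε ⟨a, by omega⟩ ⟨a + c - 1, by omega⟩
  have hsum : ∑ l ∈ Finset.range c, zeroExtend ε (a + l) =
      ∑ l ∈ Finset.Icc (⟨a, by omega⟩ : Fin n) ⟨a + c - 1, by omega⟩, ε l := by
    have h1 : Finset.range c = Finset.range (a + c - a) := by rw [Nat.add_sub_cancel_left]
    rw [h1, ← Finset.sum_Ico_eq_sum_range]
    have h2 : Finset.Ico a (a + c) =
        (Finset.Icc (⟨a, by omega⟩ : Fin n) ⟨a + c - 1, by omega⟩).map Fin.valEmbedding := by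
      rw [Fin.map_valEmbedding_Icc]
      ext i
      simp only [Finset.mem_Ico, Finset.mem_Icc]
      omega
    rw [h2, Finset.sum_map]
    exact Finset.sum_congr rfl fun i _ => zeroExtend_val ε i
  rw [← hsum, Fin.card_Icc] at h
  simp only at h
  rwa [show a + c - 1 + 1 - a = c by omega] at h

/-- A block must be short enough for the penalty to dominate the noise, yet long enough that `M ^ 2
* n / √ℓ` is of order `M ^ 3 * n / lam`. Rounding down a number at least `1` loses less than a
factor `2`. -/
theorem exists_block_length {M lam : ℝ} (hM : 0 < M) (hlam : 2 * M ≤ lam) :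
    ∃ ℓ : ℕ, 0 < ℓ ∧ M * √(ℓ : ℝ) ≤ lam / 2 ∧ lam / (4 * M) ≤ √(ℓ : ℝ) := by
  have h1 : 1 ≤ lam / (2 * M) := (one_le_div (by positivity)).2 hlam
  have h2 : 1 ≤ (lam / (2 * M)) ^ 2 := one_le_pow₀ h1
  have hfl := Nat.floor_le (show 0 ≤ (lam / (2 * M)) ^ 2 by positivity)
  have hpos : 1 ≤ ⌊(lam / (2 * M)) ^ 2⌋₊ := Nat.one_le_floor_iff _ |>.2 h2
  refine ⟨⌊(lam / (2 * M)) ^ 2⌋₊, hpos, ?_, ?_⟩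
  · have : √(⌊(lam / (2 * M)) ^ 2⌋₊ : ℝ) ≤ lam / (2 * M) :=
      Real.sqrt_le_left (by linarith) |>.2 hfl
    calc _ ≤ M * (lam / (2 * M)) := by gcongr
      _ = lam / 2 := by field_simp
  · apply Real.le_sqrt_of_sq_le
    have h3 := Nat.lt_floor_add_one ((lam / (2 * M)) ^ 2)
    have h4 : (1 : ℝ) ≤ (⌊(lam / (2 * M)) ^ 2⌋₊ : ℝ) := by exact_mod_cast hpos
    have h5 : (lam / (4 * M)) ^ 2 = (lam / (2 * M)) ^ 2 / 4 := by
      field_simp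
      norm_num
    linarith

/-- The deterministic error bound for the group fused lasso on the event that all sums of the
noise over intervals are small. -/
theorem IsGroupFusedLassoSolution.sum_sq_error_le {n p K : ℕ} {M lam : ℝ} (hM : 0 < M)
    (hlam : 2 * M ≤ lam) {ν : Fin (K + 1) → ℕ} {x ε z : Fin n → EuclideanSpace ℝ (Fin p)}
    (hx : IsPiecewiseConstant ν x)
    (hε : ∀ i j : Fin n, ‖∑ l ∈ Finset.Icc i j, ε l‖ ≤ M * √((Finset.Icc i j).card : ℝ))
    (hz : IsGroupFusedLassoSolution lam (fun i => x i + ε i) z) :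
    ∑ i, ‖z i - x i‖ ^ 2 ≤ 16 * M ^ 2 * ∑ k : Fin K, Real.log (segmentLength ν k)
      + 24 * K * M ^ 2 + 8 * lam ^ 2 * ∑ k : Fin K, 1 / (segmentLength ν k : ℝ)
      + 32 * M ^ 3 * n / lam := by
  obtain ⟨ℓ, hℓ, hℓM, hℓlam⟩ := exists_block_length hM hlam
  have hlam0 : 0 < lam := by linarith
  set d : ℕ → EuclideanSpace ℝ (Fin p) := zeroExtend (fun i => z i - x i) with hd
  have hsplit : ∀ h : ℕ → ℝ, ∑ i : Fin n, h i =
      ∑ k : Fin K, ∑ i ∈ Finset.range (segmentLength ν k), h (ν k.castSucc + i) := fun h => by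
    rw [← Finset.sum_range, sum_range_eq_sum_segments hx.strictMono hx.zero hx.last]
  have hsucc : ∀ k : Fin K, ν k.castSucc + segmentLength ν k = ν k.succ := fun k =>
    Nat.add_sub_cancel' (hx.strictMono (Fin.castSucc_lt_succ (i := k))).le
  have hle : ∀ k : Fin K, ν k.castSucc + segmentLength ν k ≤ n := fun k => by
    rw [hsucc, ← hx.last]
    exact hx.strictMono.monotone (Fin.le_last _)
  have hbasic := hz.sum_sq_le
  have hvar := variation_sub_le_sum_segments hx.strictMono hx.zero hx.last
    (x := zeroExtend x) (z := zeroExtend z) (d := d) (fun i => zeroExtend_sub z x i)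
    (zeroExtend_self _) (fun k i hi => by
      have h1 := hle k
      have h2 := hsucc k
      rw [zeroExtend_of_lt x (by omega : ν k.castSucc + i < n),
        zeroExtend_of_lt x (by omega : ν k.castSucc < n)]
      exact hx.const k _ _ ⟨by simp, by simp only; omega⟩ ⟨le_rfl, by simp only; omega⟩)
  have hsq : ∑ i, ‖z i - x i‖ ^ 2 =
      ∑ k : Fin K, ∑ i ∈ Finset.range (segmentLength ν k), ‖d (ν k.castSucc + i)‖ ^ 2 := by
    rw [← hsplit (fun i => ‖d i‖ ^ 2)]
    exact Finset.sum_congr rfl fun i _ => by rw [hd, zeroExtend_val]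
  have hinner : ∑ i, inner ℝ (ε i) (z i - x i) =
      ∑ k : Fin K, ∑ i ∈ Finset.range (segmentLength ν k),
        inner ℝ (zeroExtend ε (ν k.castSucc + i)) (d (ν k.castSucc + i)) := by
    rw [← hsplit (fun i => inner ℝ (zeroExtend ε i) (d i))]
    exact Finset.sum_congr rfl fun i _ => by rw [hd, zeroExtend_val, zeroExtend_val]
  have hn : (n : ℝ) = ∑ k : Fin K, (segmentLength ν k : ℝ) := by
    simpa using hsplit (fun _ => 1)
  have hseg : ∀ k : Fin K,
      ∑ i ∈ Finset.range (segmentLength ν k),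
          inner ℝ (zeroExtend ε (ν k.castSucc + i)) (d (ν k.castSucc + i))
        + lam / 2 * (‖d (ν k.castSucc)‖ + ‖d (ν k.castSucc + (segmentLength ν k - 1))‖
          - ∑ i ∈ Finset.range (segmentLength ν k - 1),
            ‖d (ν k.castSucc + i) - d (ν k.castSucc + (i + 1))‖) ≤
      1 / 4 * ∑ i ∈ Finset.range (segmentLength ν k), ‖d (ν k.castSucc + i)‖ ^ 2
        + (6 * M ^ 2 + 4 * M ^ 2 * Real.log (segmentLength ν k)
          + 8 * M ^ 3 / lam * segmentLength ν k
          + 2 * lam ^ 2 * (1 / (segmentLength ν k : ℝ))) := by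
    intro k
    have h := sum_inner_sub_variation_le_segment hM.le hℓ hℓM
      (segmentLength_pos hx.strictMono k) (e := fun i => zeroExtend ε (ν k.castSucc + i))
      (f := fun i => d (ν k.castSucc + i))
      (fun a c hac => by
        simpa only [add_assoc] using
          norm_sum_zeroExtend_le hε (ν k.castSucc + a) c (by have := hle k; omega))
    have h1 : M ^ 2 * (2 * (segmentLength ν k : ℝ) / √(ℓ : ℝ)) ≤
        8 * M ^ 3 / lam * segmentLength ν k := by
      calc _ ≤ M ^ 2 * (2 * (segmentLength ν k : ℝ) / (lam / (4 * M))) := by gcongr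
        _ = _ := by
          field_simp
          ring
    have h2 : 2 * lam ^ 2 * (1 / (segmentLength ν k : ℝ)) =
        2 * lam ^ 2 / (segmentLength ν k : ℝ) := by ring
    rw [h2]
    simp only [add_zero] at h
    linarith
  have htot := Finset.sum_le_sum fun k (_ : k ∈ Finset.univ) => hseg k
  rw [Finset.sum_add_distrib, Finset.sum_add_distrib, ← Finset.mul_sum, ← Finset.mul_sum,
    ← hinner, ← hsq] at htot
  simp only [Finset.sum_add_distrib (s := (Finset.univ : Finset (Fin K))), ← Finset.mul_sum,
    Finset.sum_const, Finset.card_univ, Fintype.card_fin, nsmul_eq_mul, ← hn] at htot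
  have hvar' := mul_le_mul_of_nonneg_left hvar hlam0.le
  have hfin : 32 * M ^ 3 * n / lam = 4 * (8 * M ^ 3 / lam * n) := by ring
  rw [hfin]
  -- Doubling the segment estimates leaves half of the squared error on the right; absorbing it
  -- multiplies the remainders by `4`.
  linarith

/-! ### The probabilistic statement. -/

theorem mainTheorem7
    {Ω : Type*} [MeasurableSpace Ω] (P : MeasureTheory.Measure Ω)
    [MeasureTheory.IsProbabilityMeasure P]
    (n p K : ℕ) (hK : 0 < K) (σ t lam : ℝ) (hσ : 0 < σ) (ht : 0 < t)
    (ν : Fin (K + 1) → ℕ) (x : Fin n → EuclideanSpace ℝ (Fin p))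
    (hx : IsPiecewiseConstant ν x)
    (ε : Fin n → Ω → EuclideanSpace ℝ (Fin p))
    (hε_indep : ProbabilityTheory.iIndepFun ε P)
    (hε_law : ∀ i, ProbabilityTheory.HasLaw (ε i)
      (ProbabilityTheory.multivariateGaussian 0
        (σ ^ 2 • (1 : Matrix (Fin p) (Fin p) ℝ))) P)
    (hlam_lower : 25 ^ 2 * noiseLevel σ n p t ≤ lam)
    (hlam_upper : ∀ k : Fin K,
      lam < (7 * (segmentLength ν k : ℝ) - √(segmentLength ν k : ℝ)) * noiseLevel σ n p t)
    (xhat : Ω → Fin n → EuclideanSpace ℝ (Fin p))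
    (hxhat : ∀ ω, IsGroupFusedLassoSolution lam (fun i => x i + ε i ω) (xhat ω)) :
    ENNReal.ofReal (1 - 1 / t ^ 2) ≤
      P {ω | ∑ i, ‖xhat ω i - x i‖ ^ 2 ≤
        6250 * noiseLevel σ n p t ^ 2 * ∑ k : Fin K, Real.log (segmentLength ν k)
          + 6000 * K * noiseLevel σ n p t ^ 2
          + 32 * lam ^ 2 * K / harmonicMeanLength ν
          + 125 ^ 2 * noiseLevel σ n p t ^ 3 * n / lam} := by
  have hM0 := noiseLevel_nonneg hσ.le n p t
  have hlog : 0 ≤ ∑ k : Fin K, Real.log (segmentLength ν k) :=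
    Finset.sum_nonneg fun k _ => Real.log_natCast_nonneg _
  have hlam0 : 0 ≤ lam := le_trans (by positivity) hlam_lower
  have hlen : 0 ≤ ∑ k : Fin K, 1 / (segmentLength ν k : ℝ) :=
    Finset.sum_nonneg fun k _ => by positivity
  have hharm : 32 * lam ^ 2 * K / harmonicMeanLength ν =
      32 * lam ^ 2 * ∑ k : Fin K, 1 / (segmentLength ν k : ℝ) := by
    have : (K : ℝ) ≠ 0 := by exact_mod_cast hK.ne'
    rw [harmonicMeanLength]
    field_simp
  have hn : 0 < n := by
    rw [← hx.last, ← hx.zero]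
    exact hx.strictMono (Fin.lt_def.2 (by simpa using hK))
  rw [hharm]
  refine (measure_forall_interval_sum_le hn hσ ht hε_indep hε_law).trans
    (MeasureTheory.measure_mono fun ω hω => ?_)
  simp only [Set.mem_ofPred_eq] at hω ⊢
  -- For `p = 0` the noise level may vanish, but the space is trivial.
  rcases Nat.eq_zero_or_pos p with rfl | hp
  · have hzero : ∑ i, ‖xhat ω i - x i‖ ^ 2 = 0 :=
      Finset.sum_eq_zero fun i _ => by rw [Subsingleton.elim (xhat ω i - x i) 0]; simp
    rw [hzero]
    positivity
  have hM : 0 < noiseLevel σ n p t :=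
    mul_pos hσ (lt_max_of_lt_right (by positivity))
  refine ((hxhat ω).sum_sq_error_le hM (by linarith) hx hω).trans ?_
  gcongr <;> norm_num
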